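/- Let $\mathbb F$ be an algebraically closed field of characteristic $0$, and let $\mathfrak g$ be a finite-dimensional reductive Lie algebra over $\mathbb F$ with a non-degenerate symmetric invariant bilinear form $(\cdot\,|\,\cdot)$. Let $f\in\mathfrak g$ be a nilpotent element, included in an $\mathfrak{sl}_2$-triple $\{f,2x,e\}$, i.e. $[e,f]=2x$, $[x,e]=e$, $[x,f]=-f$ (the case $f=x=e=0$ is allowed). For $k\in\frac12\mathbb Z$ put $\mathfrak g_k=\{a\in\mathfrak g\mid [x,a]=ka\}$, $\mathfrak g_{\ge j}=\bigoplus_{k\ge j}\mathfrak g_k$, $\mathfrak g_{\le j}=\bigoplus_{k\le j}\mathfrak g_k$. Let $I=U(\mathfrak g)\langle m-(f|m)\rangle_{m\in\mathfrak g_{\ge1}}$, a left ideal of $U(\mathfrak g)$, let $M=U(\mathfrak g)/I$, and let $\bar 1\in M$ be the class of $1$. Let $$\widetilde W=\{w\in U(\mathfrak g)\mid [a,w]\bar1=0\text{ in }M\text{ for all }a\in\mathfrak g_{\ge1/2}\},$$ which is a subalgebra of $U(\mathfrak g)$ containing $I$ as a two-sided ideal, and let $W(\mathfrak g,f)=\widetilde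 W/I\subset M$ be the finite $W$-algebra. Let $F(\mathfrak g_{1/2})=U(\mathfrak g_{\ge1/2})/I_{\ge1/2}$, where $I_{\ge1/2}=U(\mathfrak g_{\ge1/2})\langle m-(f|m)\rangle_{m\in\mathfrak g_{\ge1}}$ (a two-sided ideal of $U(\mathfrak g_{\ge 1/2})$), with quotient map $\pi_{1/2}:U(\mathfrak g_{\ge1/2})\to F(\mathfrak g_{1/2})$. Let $U=U(\mathfrak g_{\le0})\otimes F(\mathfrak g_{1/2})$ and $U^\circ=U(\mathfrak g_{\le0})\otimes F^{\mathrm{op}}(\mathfrak g_{1/2})$, where $F^{\mathrm{op}}(\mathfrak g_{1/2})$ is $F(\mathfrak g_{1/2})$ with the opposite product; $U$ and $U^\circ$ have the same underlying vector space. Then: 1. The multiplication map $U(\mathfrak g_{\le0})\otimes U(\mathfrak g_{\ge1/2})\to U(\mathfrak g)$, $A\otimes q\mapsto Aq$, is bijective. Hence there is a well-defined linear map $\rho:U(\mathfrak g)\to U$ with $\rho(Aq)=A\otimes\pi_{1/2}(q)$ for $A\in U(\mathfrak g_{\le0})$, $q\in U(\mathfrak g_{\ge1/2})$. 2. $\rho$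 is surjective with kernel $I$, so it induces a linear bijection $\bar\rho:M\to U$, $\bar\rho(g\bar1)=\rho(g)$. 3. $\rho$ restricts to a homomorphism of unital algebras $\widetilde W\to U^\circ$. 4. $\bar\rho$ restricts to an injective homomorphism of unital algebras $W(\mathfrak g,f)\hookrightarrow U^\circ$. -/

import Mathlib

open scoped TensorProduct

noncomputable section

namespace FiniteW

attribute [local instance] LieRing.ofAssociativeRing

/-- The data from which a finite W-algebra is built: a non-degenerate symmetric invariant bilinear
form `(a | b) = form a b` on the Lie algebra `𝔤`, and an `sl₂`-triple `{f, 2x, e}`, that is,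
`[e, f] = 2x`, `[2x, e] = 2e`, `[2x, f] = -2f`. The zero triple is allowed. -/
structure Data (F 𝔤 : Type*) [Field F] [LieRing 𝔤] [LieAlgebra F 𝔤] where
  form : LinearMap.BilinForm F 𝔤
  form_symm : form.IsSymm
  form_nondegenerate : form.Nondegenerate
  form_invariant : form.lieInvariant 𝔤
  f : 𝔤
  x : 𝔤
  e : 𝔤
  lie_e_f : ⁅e, f⁆ = (2 : F) • x
  lie_x_e : ⁅x, e⁆ = e
  lie_x_f : ⁅x, f⁆ = -f

section Grading

variable (F : Type*) {𝔤 : Type*} [Field F] [LieRing 𝔤] [LieAlgebra F 𝔤]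

/-- The eigenspace `𝔤_{k/2} = {a | [x, a] = (k/2) a}` of `ad x`, indexed by twice the degree. -/
def gr (x : 𝔤) (k : ℤ) : Submodule F 𝔤 :=
  Module.End.eigenspace (LieAlgebra.ad F 𝔤 x) ((k : F) / 2)

/-- `𝔤_{≥ n/2}`, the sum of the `𝔤_{k/2}` with `k ≥ n`. -/
def grGE (x : 𝔤) (n : ℤ) : Submodule F 𝔤 :=
  ⨆ k : ℤ, ⨆ _ : n ≤ k, gr F x k

/-- `𝔤_{≤ n/2}`, the sum of the `𝔤_{k/2}` with `k ≤ n`. -/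
def grLE (x : 𝔤) (n : ℤ) : Submodule F 𝔤 :=
  ⨆ k : ℤ, ⨆ _ : k ≤ n, gr F x k

variable {F}

theorem mem_gr {x a : 𝔤} {k : ℤ} : a ∈ gr F x k ↔ ⁅x, a⁆ = ((k : F) / 2) • a := by
  simp [gr]

theorem lie_mem_gr {x a b : 𝔤} {j k : ℤ} (ha : a ∈ gr F x j) (hb : b ∈ gr F x k) :
    ⁅a, b⁆ ∈ gr F x (j + k) := by
  rw [mem_gr] at *
  rw [leibniz_lie, ha, hb, smul_lie, lie_smul, ← add_smul]
  congr 1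
  push_cast
  ring

/-- Brackets of sums of eigenspaces. -/
theorem lie_mem_iSup {x : 𝔤} {P Q R : ℤ → Prop} (hPQ : ∀ j k, P j → Q k → R (j + k)) {a b : 𝔤}
    (ha : a ∈ ⨆ k : ℤ, ⨆ _ : P k, gr F x k) (hb : b ∈ ⨆ k : ℤ, ⨆ _ : Q k, gr F x k) :
    ⁅a, b⁆ ∈ ⨆ k : ℤ, ⨆ _ : R k, gr F x k := by
  set T : Submodule F 𝔤 := ⨆ k : ℤ, ⨆ _ : R k, gr F x k with hT
  have key : ∀ j, P j → ∀ a ∈ gr F x j, ∀ b ∈ ⨆ k : ℤ, ⨆ _ : Q k, gr F x k, ⁅a, b⁆ ∈ T := by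
    intro j hj a ha b hb
    have : (⨆ k : ℤ, ⨆ _ : Q k, gr F x k) ≤ T.comap (LieAlgebra.ad F 𝔤 a) := by
      refine iSup_le fun k => iSup_le fun hk c hc => ?_
      exact (le_iSup₂_of_le (f := fun k (_ : R k) => gr F x k) (j + k) (hPQ j k hj hk) le_rfl)
        (lie_mem_gr ha hc)
    exact this hb
  have : (⨆ k : ℤ, ⨆ _ : P k, gr F x k) ≤ T.comap (LieAlgebra.ad F 𝔤 b) := by
    refine iSup_le fun j => iSup_le fun hj c hc => ?_
    have h := key j hj c hc b hb
    change ⁅b, c⁆ ∈ T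
    rw [← lie_skew]
    exact T.neg_mem h
  have h : ⁅b, a⁆ ∈ T := this ha
  rw [← lie_skew]
  exact T.neg_mem h

theorem grGE_anti {x : 𝔤} {m n : ℤ} (h : m ≤ n) : grGE F x n ≤ grGE F x m :=
  iSup_mono fun _ => iSup_mono' fun hk => ⟨h.trans hk, le_rfl⟩

theorem lie_mem_grGE {x a b : 𝔤} {m n : ℤ} (ha : a ∈ grGE F x m) (hb : b ∈ grGE F x n) :
    ⁅a, b⁆ ∈ grGE F x (m + n) :=
  lie_mem_iSup (P := fun k => m ≤ k) (Q := fun k => n ≤ k) (R := fun k => m + n ≤ k)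
    (fun _ _ h h' => add_le_add h h') ha hb

theorem lie_mem_grLE {x a b : 𝔤} {m n : ℤ} (ha : a ∈ grLE F x m) (hb : b ∈ grLE F x n) :
    ⁅a, b⁆ ∈ grLE F x (m + n) :=
  lie_mem_iSup (P := fun k => k ≤ m) (Q := fun k => k ≤ n) (R := fun k => k ≤ m + n)
    (fun _ _ h h' => add_le_add h h') ha hb

end Grading

section WhittakerIdeal

variable {F L : Type*} [Field F] [LieRing L] [LieAlgebra F L]

/-- The left ideal `U(L)⟨m - χ(m)⟩_{m ∈ V}` of `U(L)`. -/
def whittakerIdeal (V : Submodule F L) (χ : L →ₗ[F] F) : Ideal (UniversalEnvelopingAlgebra F L) :=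
  Ideal.span {u | ∃ m ∈ V, u = UniversalEnvelopingAlgebra.ι F m -
    algebraMap F (UniversalEnvelopingAlgebra F L) (χ m)}

/-- A left ideal generated by a set is stable under right multiplication by `w` as soon as the
products of the generators with `w` are in it. -/
theorem span_mul_mem {A : Type*} [Ring A] {s : Set A} {w h : A}
    (hs : ∀ u ∈ s, u * w ∈ Ideal.span s) (hh : h ∈ Ideal.span s) : h * w ∈ Ideal.span s := by
  induction hh using Submodule.span_induction with
  | mem u hu => exact hs u hu
  | zero => simp
  | add u v _ _ hu hv => rw [add_mul]; exact Ideal.add_mem _ hu hv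
  | smul c u _ hu => rw [smul_eq_mul, mul_assoc]; exact Ideal.mul_mem_left _ c hu

theorem whittakerIdeal_mul_mem {V : Submodule F L} {χ : L →ₗ[F] F}
    {w h : UniversalEnvelopingAlgebra F L}
    (hw : ∀ m ∈ V, UniversalEnvelopingAlgebra.ι F m * w - w * UniversalEnvelopingAlgebra.ι F m ∈
      whittakerIdeal V χ)
    (hh : h ∈ whittakerIdeal V χ) : h * w ∈ whittakerIdeal V χ := by
  refine span_mul_mem ?_ hh
  rintro _ ⟨m, hm, rfl⟩
  have h1 : w * (UniversalEnvelopingAlgebra.ι F m -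
      algebraMap F (UniversalEnvelopingAlgebra F L) (χ m)) ∈ whittakerIdeal V χ :=
    Ideal.mul_mem_left _ _ (Ideal.subset_span ⟨m, hm, rfl⟩)
  have h2 := Ideal.add_mem _ h1 (hw m hm)
  have h3 := Algebra.commutes (χ m) w
  have h4 : (UniversalEnvelopingAlgebra.ι F m -
      algebraMap F (UniversalEnvelopingAlgebra F L) (χ m)) * w =
      w * (UniversalEnvelopingAlgebra.ι F m -
        algebraMap F (UniversalEnvelopingAlgebra F L) (χ m)) +
      (UniversalEnvelopingAlgebra.ι F m * w - w * UniversalEnvelopingAlgebra.ι F m) := by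
    rw [sub_mul, mul_sub, h3]
    abel
  rw [h4]
  exact h2

theorem whittakerIdeal_mul_ι_mem {V : Submodule F L} {χ : L →ₗ[F] F} {a : L}
    (ha : ∀ m ∈ V, ⁅m, a⁆ ∈ V ∧ χ ⁅m, a⁆ = 0) {h : UniversalEnvelopingAlgebra F L}
    (hh : h ∈ whittakerIdeal V χ) :
    h * UniversalEnvelopingAlgebra.ι F a ∈ whittakerIdeal V χ := by
  refine whittakerIdeal_mul_mem (fun m hm => ?_) hh
  rw [← LieRing.of_associative_ring_bracket, ← LieHom.map_lie]
  refine Ideal.subset_span ⟨_, (ha m hm).1, ?_⟩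
  rw [(ha m hm).2, map_zero, sub_zero]

/-- A subalgebra of `U(L)` that contains `L` is everything. -/
theorem mem_of_ι_mem (S : Subalgebra F (UniversalEnvelopingAlgebra F L))
    (hS : ∀ a, UniversalEnvelopingAlgebra.ι F a ∈ S) (u : UniversalEnvelopingAlgebra F L) :
    u ∈ S := by
  let g : L →ₗ⁅F⁆ S :=
    { toFun := fun a => ⟨UniversalEnvelopingAlgebra.ι F a, hS a⟩
      map_add' := fun a b => Subtype.ext (map_add _ a b)
      map_smul' := fun c a => Subtype.ext (map_smul _ c a)
      map_lie' := fun {a b} => Subtype.ext (LieHom.map_lie _ a b) }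
  have h : S.val.comp (UniversalEnvelopingAlgebra.lift F g) = AlgHom.id F _ := by
    apply UniversalEnvelopingAlgebra.hom_ext
    ext a
    have := UniversalEnvelopingAlgebra.lift_ι_apply F g a
    change ((UniversalEnvelopingAlgebra.lift F g (UniversalEnvelopingAlgebra.ι F a) : S) :
      UniversalEnvelopingAlgebra F L) = UniversalEnvelopingAlgebra.ι F a
    rw [this]
    rfl
  have := DFunLike.congr_fun h u
  rw [← AlgHom.id_apply (R := F) u, ← this]
  exact (UniversalEnvelopingAlgebra.lift F g u).2

theorem whittakerIdeal_isTwoSided {V : Submodule F L} {χ : L →ₗ[F] F}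
    (h : ∀ m ∈ V, ∀ a, ⁅m, a⁆ ∈ V ∧ χ ⁅m, a⁆ = 0) : (whittakerIdeal V χ).IsTwoSided := by
  let S : Subalgebra F (UniversalEnvelopingAlgebra F L) :=
    { carrier := {w | ∀ u ∈ whittakerIdeal V χ, u * w ∈ whittakerIdeal V χ}
      mul_mem' := fun {v w} hv hw u hu => by
        rw [← mul_assoc]; exact hw _ (hv _ hu)
      add_mem' := fun {v w} hv hw u hu => by
        rw [mul_add]; exact Ideal.add_mem _ (hv _ hu) (hw _ hu)
      algebraMap_mem' := fun c u hu => by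
        rw [← Algebra.commutes]; exact Ideal.mul_mem_left _ _ hu }
  refine ⟨fun {u} w hu => ?_⟩
  exact mem_of_ι_mem S (fun a u hu => whittakerIdeal_mul_ι_mem (fun m hm => h m hm a) hu) w u hu

end WhittakerIdeal

namespace Data

variable {F 𝔤 : Type*} [Field F] [CharZero F] [LieRing 𝔤] [LieAlgebra F 𝔤] (D : Data F 𝔤)

/-- The linear form `a ↦ (f | a)` on `𝔤`. -/
def χ : 𝔤 →ₗ[F] F := D.form D.f

/-- `(f | a) = 0` for `a ∈ 𝔤_{≥ 3/2}`. -/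
theorem χ_eq_zero {a : 𝔤} (ha : a ∈ grGE F D.x 3) : D.χ a = 0 := by
  have : grGE F D.x 3 ≤ LinearMap.ker D.χ := by
    refine iSup_le fun k => iSup_le fun hk b hb => ?_
    rw [mem_gr] at hb
    have h := D.form_invariant D.x D.f b
    rw [D.lie_x_f, hb, map_neg, LinearMap.neg_apply, map_smul, neg_inj, smul_eq_mul] at h
    have h2 : ((k : F) / 2 - 1) * D.form D.f b = 0 := by rw [sub_mul, ← h]; ring
    rcases mul_eq_zero.1 h2 with h3 | h3
    · exfalso
      have h4 : (k : F) = 2 := by linear_combination 2 * h3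
      have h5 : k = 2 := by exact_mod_cast h4
      omega
    · exact h3
  exact this ha

/-- The Lie subalgebra `𝔤_{≤ 0}`. -/
def gLE0 : LieSubalgebra F 𝔤 :=
  { grLE F D.x 0 with lie_mem' := fun {_ _} ha hb => lie_mem_grLE (m := 0) (n := 0) ha hb }

/-- The Lie subalgebra `𝔤_{≥ 1/2}`. -/
def gGEhalf : LieSubalgebra F 𝔤 :=
  { grGE F D.x 1 with
    lie_mem' := fun {_ _} ha hb =>
      grGE_anti (by norm_num) (lie_mem_grGE (m := 1) (n := 1) ha hb) }

/-- The subspace `𝔤_{≥ 1}`. -/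
def gGE1 : Submodule F 𝔤 := grGE F D.x 2

/-- The algebra homomorphism `U(𝔥) → U(𝔤)` induced by the inclusion of a Lie subalgebra. -/
def _root_.FiniteW.incl (𝔥 : LieSubalgebra F 𝔤) :
    UniversalEnvelopingAlgebra F 𝔥 →ₐ[F] UniversalEnvelopingAlgebra F 𝔤 :=
  UniversalEnvelopingAlgebra.lift F ((UniversalEnvelopingAlgebra.ι F).comp 𝔥.incl)

/-- The left ideal `I = U(𝔤)⟨m - (f|m)⟩_{m ∈ 𝔤_{≥1}}` of `U(𝔤)`. -/
def I : Ideal (UniversalEnvelopingAlgebra F 𝔤) := whittakerIdeal D.gGE1 D.χ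

/-- The left ideal `I_{≥1/2} = U(𝔤_{≥1/2})⟨m - (f|m)⟩_{m ∈ 𝔤_{≥1}}` of `U(𝔤_{≥1/2})`. -/
def IGEhalf : Ideal (UniversalEnvelopingAlgebra F D.gGEhalf) :=
  whittakerIdeal (D.gGE1.comap (D.gGEhalf.incl : D.gGEhalf →ₗ[F] 𝔤))
    (D.χ.comp (D.gGEhalf.incl : D.gGEhalf →ₗ[F] 𝔤))

theorem lie_mem_and_χ {m a : 𝔤} (hm : m ∈ D.gGE1) (ha : a ∈ D.gGEhalf) :
    ⁅m, a⁆ ∈ D.gGE1 ∧ D.χ ⁅m, a⁆ = 0 := by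
  have h : ⁅m, a⁆ ∈ grGE F D.x 3 := lie_mem_grGE (m := 2) (n := 1) hm ha
  exact ⟨grGE_anti (by norm_num) h, D.χ_eq_zero h⟩

instance IGEhalf_isTwoSided : D.IGEhalf.IsTwoSided :=
  whittakerIdeal_isTwoSided fun _ hm a => D.lie_mem_and_χ hm a.2

/-- The algebra `F(𝔤_{1/2}) = U(𝔤_{≥1/2}) / I_{≥1/2}` (the Weyl algebra of `𝔤_{1/2}`). -/
abbrev Weyl : Type _ := UniversalEnvelopingAlgebra F D.gGEhalf ⧸ D.IGEhalf

/-- The quotient map `π_{1/2} : U(𝔤_{≥1/2}) → F(𝔤_{1/2})`. -/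
def π : UniversalEnvelopingAlgebra F D.gGEhalf →ₐ[F] D.Weyl := Ideal.Quotient.mkₐ F D.IGEhalf

/-- The algebra `U = U(𝔤_{≤0}) ⊗ F(𝔤_{1/2})`. -/
abbrev U : Type _ := UniversalEnvelopingAlgebra F D.gLE0 ⊗[F] D.Weyl

/-- The algebra `U° = U(𝔤_{≤0}) ⊗ F^op(𝔤_{1/2})`. -/
abbrev Uop : Type _ := UniversalEnvelopingAlgebra F D.gLE0 ⊗[F] D.Weylᵐᵒᵖ

/-- The identification of the underlying vector spaces of `U` and `U°`. -/
def toOp : D.U ≃ₗ[F] D.Uop :=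
  TensorProduct.congr (LinearEquiv.refl F _) (MulOpposite.opLinearEquiv F)

/-- The multiplication map `A ⊗ q ↦ A q` from `U(𝔤_{≤0}) ⊗ U(𝔤_{≥1/2})` to `U(𝔤)`. -/
def pbwMul : UniversalEnvelopingAlgebra F D.gLE0 ⊗[F] UniversalEnvelopingAlgebra F D.gGEhalf →ₗ[F]
    UniversalEnvelopingAlgebra F 𝔤 :=
  LinearMap.mul' F (UniversalEnvelopingAlgebra F 𝔤) ∘ₗ
    TensorProduct.map (incl D.gLE0).toLinearMap (incl D.gGEhalf).toLinearMap

/-- The linear map `ρ`: the inverse of the multiplication map `pbwMul` (which is bijective by the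
PBW theorem), followed by `id ⊗ π_{1/2}`. -/
def ρ (h : Function.Bijective D.pbwMul) : UniversalEnvelopingAlgebra F 𝔤 →ₗ[F] D.U :=
  TensorProduct.map LinearMap.id D.π.toLinearMap ∘ₗ
    (LinearEquiv.ofBijective D.pbwMul h).symm.toLinearMap

/-- The left `𝔤`-module `M = U(𝔤) / I`, a left module over `U(𝔤)`. -/
abbrev M : Type _ := UniversalEnvelopingAlgebra F 𝔤 ⧸ D.I

/-- The map `g ↦ g 1̄` from `U(𝔤)` to `M`. -/
def toM : UniversalEnvelopingAlgebra F 𝔤 →ₗ[F] D.M := D.I.mkQ.restrictScalars F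

theorem toM_eq_zero {g : UniversalEnvelopingAlgebra F 𝔤} : D.toM g = 0 ↔ g ∈ D.I :=
  Submodule.Quotient.mk_eq_zero D.I

/-- The subalgebra `W̃` of those `w ∈ U(𝔤)` with `[a, w] 1̄ = 0` in `M` for all `a ∈ 𝔤_{≥1/2}`. -/
def Wtilde : Subalgebra F (UniversalEnvelopingAlgebra F 𝔤) where
  carrier := {w | ∀ a ∈ D.gGEhalf, D.toM (UniversalEnvelopingAlgebra.ι F a * w -
    w * UniversalEnvelopingAlgebra.ι F a) = 0}
  add_mem' := fun {v w} hv hw a ha => by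
    have := congrArg₂ (· + ·) (hv a ha) (hw a ha)
    simp only [← map_add, add_zero] at this
    rw [← this]
    congr 1
    rw [mul_add, add_mul]
    abel
  mul_mem' := fun {v w} hv hw a ha => by
    have h1 := D.toM_eq_zero.1 (hv a ha)
    have h2 : (UniversalEnvelopingAlgebra.ι F a * v - v * UniversalEnvelopingAlgebra.ι F a) * w ∈
        D.I :=
      whittakerIdeal_mul_mem
        (fun m hm => D.toM_eq_zero.1 (hw m (grGE_anti (by norm_num) hm))) h1
    have h3 := Ideal.mul_mem_left D.I v (D.toM_eq_zero.1 (hw a ha))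
    rw [toM_eq_zero]
    convert Ideal.add_mem _ h2 h3 using 1
    noncomm_ring
  algebraMap_mem' := fun c a _ => by
    rw [Algebra.commutes, sub_self, map_zero]

theorem mem_Wtilde {w : UniversalEnvelopingAlgebra F 𝔤} :
    w ∈ D.Wtilde ↔ ∀ a ∈ D.gGEhalf, D.toM (UniversalEnvelopingAlgebra.ι F a * w -
      w * UniversalEnvelopingAlgebra.ι F a) = 0 :=
  Iff.rfl

/-- `I` is contained in `W̃`. -/
theorem I_le_Wtilde {w : UniversalEnvelopingAlgebra F 𝔤} (hw : w ∈ D.I) : w ∈ D.Wtilde :=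
  fun _ ha => D.toM_eq_zero.2 (Ideal.sub_mem _ (Ideal.mul_mem_left _ _ hw)
    (whittakerIdeal_mul_ι_mem (fun _ hm => D.lie_mem_and_χ hm ha) hw))

/-- `I` as an ideal of `W̃`. -/
def IW : Ideal D.Wtilde := D.I.comap (D.Wtilde.val : D.Wtilde →+* UniversalEnvelopingAlgebra F 𝔤)

theorem mem_IW {w : D.Wtilde} : w ∈ D.IW ↔ (w : UniversalEnvelopingAlgebra F 𝔤) ∈ D.I :=
  Iff.rfl

instance IW_isTwoSided : D.IW.IsTwoSided :=
  ⟨fun w hu => whittakerIdeal_mul_mem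
    (fun m hm => D.toM_eq_zero.1 (w.2 m (grGE_anti (by norm_num) hm))) hu⟩

/-- The finite W-algebra `W(𝔤, f) = W̃ / I`. -/
abbrev W : Type _ := D.Wtilde ⧸ D.IW

/-- The quotient map `W̃ → W(𝔤, f)`. -/
def toW : D.Wtilde →ₐ[F] D.W := Ideal.Quotient.mkₐ F D.IW

/-- The inclusion of `W(𝔤, f) = W̃ / I` in `M = U(𝔤) / I`, which sends the class of `w` to `w 1̄`. -/
def WtoM : D.W →ₗ[F] D.M :=
  Submodule.liftQ (D.IW.restrictScalars F) (D.toM ∘ₗ D.Wtilde.val.toLinearMap)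
    fun _ hw => D.toM_eq_zero.2 hw

theorem WtoM_toW (w : D.Wtilde) : D.WtoM (D.toW w) = D.toM w := rfl

theorem WtoM_injective : Function.Injective D.WtoM := by
  rw [injective_iff_map_eq_zero]
  intro y hy
  obtain ⟨w, rfl⟩ := Ideal.Quotient.mkₐ_surjective F D.IW y
  exact Ideal.Quotient.eq_zero_iff_mem.2 (D.toM_eq_zero.1 hy)

end Data

end FiniteW

end

/-! Three ingredients carry the proof. Bijectivity of `A ⊗ q ↦ A q` holds for any splitting `L = 𝔞 ⊕
𝔟` into subalgebras (`mul_incl_bijective`), without choosing ordered bases. One makes `L` act on `V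
= U(𝔞) ⊗ U(𝔟)` as it would on `U(L)`, and `u ↦ u · (1 ⊗ 1)` then inverts multiplication. The action
is encoded as an `𝔞`-equivariant map `V → Hom(L, V)`, so it is determined by its values on `1 ⊗
U(𝔟)`. The splitting `𝔤 = 𝔤_{≤0} ⊕ 𝔤_{≥1/2}` requires `ad 2x` to be diagonalizable with integer
eigenvalues. This is proved directly for finite-dimensional `sl₂`-modules
(`iSup_eigenspace_eq_top`), without complete reducibility. Finally, `ρ` is left `U(𝔤_{≤0})`-linear
and right `U(𝔤_{≥1/2})`-linear, and its kernel is `I` (`ker_ρ`). For `w ∈ W̃` one has `q w ≡ w q`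
modulo `I`, so `ρ(A q w) = (A ⊗ 1) ρ(w) (1 ⊗ π(q))`. The factor `π(q)` ends up on the right, and
this is the product of `U°` (`toOp_ρ_mul`). -/

noncomputable section

namespace FiniteW

attribute [local instance] LieRing.ofAssociativeRing

open UniversalEnvelopingAlgebra

/-! ### Triangular decomposition of an enveloping algebra. -/

section TriangularDecomposition

variable {F L : Type*} [Field F] [LieRing L] [LieAlgebra F L] {𝔞 𝔟 : LieSubalgebra F L}

theorem incl_ι (𝔥 : LieSubalgebra F L) (a : 𝔥) : incl 𝔥 (ι F a) = ι F (a : L) := by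
  rw [incl, lift_ι_apply]; rfl

/-- A linear subspace of `U(𝔞) ⊗ N` that contains `1 ⊗ N` and is
stable under left multiplication by `𝔞` is everything. -/
theorem tensor_induction {N : Type*} [Ring N] [Algebra F N]
    (S : Submodule F (UniversalEnvelopingAlgebra F 𝔞 ⊗[F] N)) (h1 : ∀ q : N, 1 ⊗ₜ q ∈ S)
    (hS : ∀ a : 𝔞, ∀ v ∈ S, (ι F a ⊗ₜ 1) * v ∈ S) (v : UniversalEnvelopingAlgebra F 𝔞 ⊗[F] N) :
    v ∈ S := by
  let T : Subalgebra F (UniversalEnvelopingAlgebra F 𝔞) :=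
    { carrier := {A | ∀ v ∈ S, (A ⊗ₜ 1) * v ∈ S}
      mul_mem' := fun {A B} hA hB v hv => by
        have := hA _ (hB v hv)
        rwa [← mul_assoc, Algebra.TensorProduct.tmul_mul_tmul, one_mul] at this
      add_mem' := fun {A B} hA hB v hv => by
        rw [TensorProduct.add_tmul, add_mul]
        exact S.add_mem (hA v hv) (hB v hv)
      algebraMap_mem' := fun c v hv => by
        rw [Algebra.algebraMap_eq_smul_one, ← TensorProduct.smul_tmul',
          ← Algebra.TensorProduct.one_def, smul_mul_assoc, one_mul]
        exact S.smul_mem c hv }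
  induction v with
  | zero => exact S.zero_mem
  | add v w hv hw => exact S.add_mem hv hw
  | tmul A q =>
    have := mem_of_ι_mem T hS A _ (h1 q)
    rwa [Algebra.TensorProduct.tmul_mul_tmul, mul_one, one_mul] at this

/-- The Lie module `Hom(L, V)` of `𝔞`, where `V = U(𝔞) ⊗ U(𝔟)` and `L` carries the adjoint
action. -/
def homAction (𝔞 𝔟 : LieSubalgebra F L) :
    𝔞 →ₗ⁅F⁆ Module.End F
      (L →ₗ[F] UniversalEnvelopingAlgebra F 𝔞 ⊗[F] UniversalEnvelopingAlgebra F 𝔟) where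
  toFun a :=
    { toFun := fun Φ => LinearMap.mulLeft F (ι F a ⊗ₜ 1) ∘ₗ Φ - Φ ∘ₗ LieAlgebra.ad F L (a : L)
      map_add' := fun Φ Ψ => by ext y; simp [mul_add]; abel
      map_smul' := fun c Φ => by ext y; simp [smul_sub] }
  map_add' a b := by
    ext Φ y
    simp [TensorProduct.add_tmul, add_mul]; abel
  map_smul' c a := by
    ext Φ y
    simp [smul_sub, ← TensorProduct.smul_tmul']
  map_lie' {a b} := by
    ext Φ y
    have h : (ι F ⁅a, b⁆ : UniversalEnvelopingAlgebra F 𝔞) ⊗ₜ[F]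
        (1 : UniversalEnvelopingAlgebra F 𝔟) =
        (ι F a ⊗ₜ 1) * (ι F b ⊗ₜ 1) - (ι F b ⊗ₜ 1) * (ι F a ⊗ₜ 1) := by
      rw [LieHom.map_lie, LieRing.of_associative_ring_bracket]
      simp [TensorProduct.sub_tmul]
    simp only [LinearMap.coe_mk, AddHom.coe_mk, LinearMap.sub_apply, LinearMap.comp_apply,
      LinearMap.mulLeft_apply, LieAlgebra.ad_apply, LieRing.of_associative_ring_bracket,
      Module.End.mul_apply, h, LieSubalgebra.coe_bracket, lie_lie, map_sub, sub_mul, mul_assoc]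
    abel

variable (h : IsCompl 𝔞.toSubmodule 𝔟.toSubmodule)

/-- The action of `y ∈ L` on `1 ⊗ q`. -/
def actionOnOne : UniversalEnvelopingAlgebra F 𝔟 →ₗ[F]
    L →ₗ[F] UniversalEnvelopingAlgebra F 𝔞 ⊗[F] UniversalEnvelopingAlgebra F 𝔟 :=
  (TensorProduct.mk F _ _ ∘ₗ (ι F : 𝔞 →ₗ⁅F⁆ _).toLinearMap ∘ₗ
      𝔞.toSubmodule.projectionOnto 𝔟.toSubmodule h).flip +
    ((LinearMap.mul F (UniversalEnvelopingAlgebra F 𝔟) ∘ₗ (ι F : 𝔟 →ₗ⁅F⁆ _).toLinearMap ∘ₗ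
      𝔟.toSubmodule.projectionOnto 𝔞.toSubmodule h.symm).compr₂ (TensorProduct.mk F _ _ 1)).flip

theorem actionOnOne_left (q : UniversalEnvelopingAlgebra F 𝔟) (a : 𝔞) :
    actionOnOne h q (a : L) = ι F a ⊗ₜ q := by
  have h1 : 𝔞.toSubmodule.projectionOnto 𝔟.toSubmodule h (a : L) = a :=
    Submodule.projectionOnto_apply_left h a
  have h2 : 𝔟.toSubmodule.projectionOnto 𝔞.toSubmodule h.symm (a : L) = 0 :=
    Submodule.projectionOnto_apply_right h.symm a
  simp [actionOnOne, h1, h2]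

theorem actionOnOne_right (q : UniversalEnvelopingAlgebra F 𝔟) (b : 𝔟) :
    actionOnOne h q (b : L) = 1 ⊗ₜ (ι F b * q) := by
  have h1 : 𝔞.toSubmodule.projectionOnto 𝔟.toSubmodule h (b : L) = 0 :=
    Submodule.projectionOnto_apply_right h b
  have h2 : 𝔟.toSubmodule.projectionOnto 𝔞.toSubmodule h.symm (b : L) = b :=
    Submodule.projectionOnto_apply_left h.symm b
  simp [actionOnOne, h1, h2]

/-- The action of `L` on `U(𝔞) ⊗ U(𝔟)`, as the `𝔞`-equivariant map to `Hom(L, U(𝔞) ⊗ U(𝔟))`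
which extends `actionOnOne`. -/
def tensorAction : UniversalEnvelopingAlgebra F 𝔞 ⊗[F] UniversalEnvelopingAlgebra F 𝔟 →ₗ[F]
    L →ₗ[F] UniversalEnvelopingAlgebra F 𝔞 ⊗[F] UniversalEnvelopingAlgebra F 𝔟 :=
  TensorProduct.lift ((lift F (homAction 𝔞 𝔟)).toLinearMap.compl₂ (actionOnOne h))

theorem tensorAction_one_tmul (q : UniversalEnvelopingAlgebra F 𝔟) :
    tensorAction h (1 ⊗ₜ q) = actionOnOne h q := by
  simp [tensorAction]

/-- Equivariance, unwound: this is the rule `y a = a y + [y, a]`, which reduces the action on all of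
`V` to the action on `1 ⊗ U(𝔟)`. -/
theorem tensorAction_mul (a : 𝔞)
    (v : UniversalEnvelopingAlgebra F 𝔞 ⊗[F] UniversalEnvelopingAlgebra F 𝔟) (y : L) :
    tensorAction h ((ι F a ⊗ₜ 1) * v) y =
      (ι F a ⊗ₜ 1) * tensorAction h v y + tensorAction h v ⁅y, (a : L)⁆ := by
  have key : tensorAction h ((ι F a ⊗ₜ 1) * v) = homAction 𝔞 𝔟 a (tensorAction h v) := by
    induction v with
    | zero => simp
    | add v w hv hw => rw [mul_add, map_add, map_add, map_add, hv, hw]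
    | tmul A q =>
      rw [Algebra.TensorProduct.tmul_mul_tmul, one_mul]
      change lift F (homAction 𝔞 𝔟) (ι F a * A) (actionOnOne h q) =
        homAction 𝔞 𝔟 a (lift F (homAction 𝔞 𝔟) A (actionOnOne h q))
      rw [map_mul, lift_ι_apply, Module.End.mul_apply]
  rw [key, ← lie_skew y (a : L), map_neg, ← sub_eq_add_neg]
  rfl

/-- By induction on the left factor: `a · (b v) = b (a v) + [a, b] v = a b v` for `b ∈ 𝔞`. -/
theorem tensorAction_left (a : 𝔞)
    (v : UniversalEnvelopingAlgebra F 𝔞 ⊗[F] UniversalEnvelopingAlgebra F 𝔟) :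
    tensorAction h v (a : L) = (ι F a ⊗ₜ 1) * v := by
  let S : Submodule F (UniversalEnvelopingAlgebra F 𝔞 ⊗[F] UniversalEnvelopingAlgebra F 𝔟) :=
    { carrier := {v | ∀ a : 𝔞, tensorAction h v (a : L) = (ι F a ⊗ₜ 1) * v}
      add_mem' := fun {v w} hv hw a => by
        rw [map_add, LinearMap.add_apply, hv a, hw a, mul_add]
      zero_mem' := fun a => by simp
      smul_mem' := fun c v hv a => by
        rw [map_smul, LinearMap.smul_apply, hv a, mul_smul_comm] }
  refine tensor_induction S (fun q a => ?_) (fun b v hv a => ?_) v a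
  · rw [tensorAction_one_tmul, actionOnOne_left, Algebra.TensorProduct.tmul_mul_tmul, mul_one,
      one_mul]
  · rw [tensorAction_mul, hv, ← LieSubalgebra.coe_bracket, hv, LieHom.map_lie,
      LieRing.of_associative_ring_bracket, TensorProduct.sub_tmul, sub_mul, ← mul_assoc,
      ← mul_assoc, Algebra.TensorProduct.tmul_mul_tmul, Algebra.TensorProduct.tmul_mul_tmul,
      one_mul]
    abel

theorem exists_eq_add (h : IsCompl 𝔞.toSubmodule 𝔟.toSubmodule) (y : L) :
    ∃ (a : 𝔞) (b : 𝔟), (a : L) + b = y := by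
  obtain ⟨a, ha, b, hb, hab⟩ := Submodule.mem_sup.1
    (h.sup_eq_top ▸ Submodule.mem_top : y ∈ 𝔞.toSubmodule ⊔ 𝔟.toSubmodule)
  exact ⟨⟨a, ha⟩, ⟨b, hb⟩, hab⟩

/-- The Jacobi identity propagates the module axiom from `v` to `a v`, so only `v = 1 ⊗ q` matters.
-/
theorem tensorAction_lie (v : UniversalEnvelopingAlgebra F 𝔞 ⊗[F] UniversalEnvelopingAlgebra F 𝔟)
    (y z : L) : tensorAction h v ⁅y, z⁆ =
      tensorAction h (tensorAction h v z) y - tensorAction h (tensorAction h v y) z := by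
  let S : Submodule F (UniversalEnvelopingAlgebra F 𝔞 ⊗[F] UniversalEnvelopingAlgebra F 𝔟) :=
    { carrier := {v | ∀ y z : L, tensorAction h v ⁅y, z⁆ =
        tensorAction h (tensorAction h v z) y - tensorAction h (tensorAction h v y) z}
      add_mem' := fun {v w} hv hw y z => by
        simp only [map_add, LinearMap.add_apply, hv y z, hw y z]
        abel
      zero_mem' := fun y z => by simp
      smul_mem' := fun c v hv y z => by
        simp only [map_smul, LinearMap.smul_apply, hv y z, smul_sub] }
  refine tensor_induction S (fun q y z => ?_) (fun a v hv y z => ?_) v y z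
  · obtain ⟨a, b, rfl⟩ := exists_eq_add h y
    obtain ⟨c, d, rfl⟩ := exists_eq_add h z
    -- If one entry lies in `𝔞`, the axiom is `tensorAction_mul` itself; only `𝔟` against `𝔟`
    -- remains, where `𝔟` acts on `1 ⊗ U(𝔟)` by left multiplication.
    have h1 : ∀ (a : 𝔞) (y : L) (v), tensorAction h v ⁅y, (a : L)⁆ =
        tensorAction h (tensorAction h v a) y - tensorAction h (tensorAction h v y) a := by
      intro a y v
      rw [tensorAction_left, tensorAction_left, tensorAction_mul]
      abel
    have h2 : tensorAction h (1 ⊗ₜ q) ⁅(b : L), (d : L)⁆ =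
        tensorAction h (tensorAction h (1 ⊗ₜ q) d) b -
          tensorAction h (tensorAction h (1 ⊗ₜ q) b) d := by
      rw [← LieSubalgebra.coe_bracket]
      simp only [tensorAction_one_tmul, actionOnOne_right]
      rw [← TensorProduct.tmul_sub, ← mul_assoc, ← mul_assoc, ← sub_mul, LieHom.map_lie,
        LieRing.of_associative_ring_bracket]
    rw [lie_add, map_add, h1, add_lie, map_add, ← lie_skew (a : L) (d : L),
      map_add (tensorAction h (1 ⊗ₜ q)) (-_), map_neg, h1, h2]
    simp only [map_add, LinearMap.add_apply]
    abel
  · have e1 : ⁅⁅y, z⁆, (a : L)⁆ = ⁅⁅y, (a : L)⁆, z⁆ + ⁅y, ⁅z, (a : L)⁆⁆ := by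
      rw [lie_lie, ← lie_skew ⁅y, (a : L)⁆ z]
      abel
    have hv' : ∀ y z, tensorAction h v ⁅y, z⁆ =
      tensorAction h (tensorAction h v z) y - tensorAction h (tensorAction h v y) z := hv
    simp only [tensorAction_mul, hv', e1, map_add, LinearMap.add_apply, mul_sub]
    abel

/-- The multiplication map `U(𝔞) ⊗ U(𝔟) → U(L)` is bijective if `L = 𝔞 ⊕ 𝔟`. -/
theorem mul_incl_bijective (h : IsCompl 𝔞.toSubmodule 𝔟.toSubmodule) :
    Function.Bijective (LinearMap.mul' F (UniversalEnvelopingAlgebra F L) ∘ₗ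
      TensorProduct.map (incl 𝔞).toLinearMap (incl 𝔟).toLinearMap) := by
  set m := LinearMap.mul' F (UniversalEnvelopingAlgebra F L) ∘ₗ
    TensorProduct.map (incl 𝔞).toLinearMap (incl 𝔟).toLinearMap with hm
  have m_tmul : ∀ A q, m (A ⊗ₜ q) = incl 𝔞 A * incl 𝔟 q := fun A q => by simp [hm]
  have m_mul : ∀ (a : 𝔞) v, m ((ι F a ⊗ₜ 1) * v) = ι F (a : L) * m v := by
    intro a v
    induction v with
    | zero => simp
    | add v w hv hw => rw [mul_add, map_add, map_add, mul_add, hv, hw]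
    | tmul A q =>
      rw [Algebra.TensorProduct.tmul_mul_tmul, one_mul, m_tmul, m_tmul, map_mul, incl_ι, mul_assoc]
  have m_one : ∀ q, m (1 ⊗ₜ q) = incl 𝔟 q := fun q => by
    rw [m_tmul, map_one, one_mul]
  let g : L →ₗ⁅F⁆ Module.End F
      (UniversalEnvelopingAlgebra F 𝔞 ⊗[F] UniversalEnvelopingAlgebra F 𝔟) :=
    { (tensorAction h).flip with
      map_lie' := fun {y z} => LinearMap.ext fun v => tensorAction_lie h v y z }
  have hg : ∀ y v, lift F g (ι F y) v = tensorAction h v y := fun y v => by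
    rw [lift_ι_apply]; rfl
  have g_left : ∀ A v, lift F g (incl 𝔞 A) v = (A ⊗ₜ 1) * v := by
    have : (lift F g).comp (incl 𝔞) =
        (Algebra.lmul F _).comp Algebra.TensorProduct.includeLeft := by
      apply hom_ext
      ext1 a
      refine LinearMap.ext fun v => ?_
      change lift F g (incl 𝔞 (ι F a)) v = (ι F a ⊗ₜ 1) * v
      rw [incl_ι, hg, tensorAction_left]
    exact fun A v => congrArg (fun k => k A v) this
  -- This is restricted to `1 ⊗ r`: on a general tensor, `𝔟` must first be commuted past `U(𝔞)`.
  have g_right : ∀ q r, lift F g (incl 𝔟 q) (1 ⊗ₜ r) = 1 ⊗ₜ (q * r) := by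
    intro q
    let T : Subalgebra F (UniversalEnvelopingAlgebra F 𝔟) :=
      { carrier := {q | ∀ r, lift F g (incl 𝔟 q) (1 ⊗ₜ r) = 1 ⊗ₜ (q * r)}
        mul_mem' := fun {q q'} hq hq' r => by
          rw [map_mul, map_mul, Module.End.mul_apply, hq', hq, mul_assoc]
        add_mem' := fun {q q'} hq hq' r => by
          rw [map_add, map_add, LinearMap.add_apply, hq, hq', add_mul, TensorProduct.tmul_add]
        algebraMap_mem' := fun c r => by
          rw [AlgHom.commutes, AlgHom.commutes, Module.algebraMap_end_apply, ← Algebra.smul_def,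
            TensorProduct.tmul_smul] }
    exact mem_of_ι_mem T (fun b r => by
      rw [incl_ι, hg, tensorAction_one_tmul, actionOnOne_right]) q
  have left_inv : ∀ v, lift F g (m v) (1 ⊗ₜ 1) = v := by
    intro v
    induction v with
    | zero => simp
    | add v w hv hw => rw [map_add, map_add, LinearMap.add_apply, hv, hw]
    | tmul A q =>
      rw [m_tmul, map_mul, Module.End.mul_apply, g_right, g_left,
        Algebra.TensorProduct.tmul_mul_tmul, mul_one, mul_one, one_mul]
  -- Hence the range of `m` is stable under left multiplication by `L`; since it contains `1`, it is
  -- everything.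
  have m_action : ∀ v y, m (tensorAction h v y) = ι F y * m v := by
    intro v y
    let S : Submodule F (UniversalEnvelopingAlgebra F 𝔞 ⊗[F] UniversalEnvelopingAlgebra F 𝔟) :=
      { carrier := {v | ∀ y, m (tensorAction h v y) = ι F y * m v}
        add_mem' := fun {v w} hv hw y => by
          simp only [map_add, LinearMap.add_apply, hv y, hw y, mul_add]
        zero_mem' := fun y => by simp
        smul_mem' := fun c v hv y => by
          simp only [map_smul, LinearMap.smul_apply, hv y, mul_smul_comm] }
    refine tensor_induction S (fun q y => ?_) (fun a v hv y => ?_) v y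
    · obtain ⟨a, b, rfl⟩ := exists_eq_add h y
      rw [tensorAction_one_tmul, map_add, actionOnOne_left, actionOnOne_right, map_add, map_add,
        m_one, m_one, map_mul, incl_ι, add_mul, ← m_one q, ← m_mul,
        Algebra.TensorProduct.tmul_mul_tmul, mul_one, one_mul]
    · rw [tensorAction_mul, map_add, m_mul, m_mul, hv, hv, LieHom.map_lie,
        LieRing.of_associative_ring_bracket, sub_mul, ← mul_assoc, ← mul_assoc]
      abel
  refine ⟨Function.LeftInverse.injective (g := fun u => lift F g u (1 ⊗ₜ 1)) left_inv, fun u => ?_⟩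
  let S : Subalgebra F (UniversalEnvelopingAlgebra F L) :=
    { carrier := {u | ∀ w ∈ LinearMap.range m, u * w ∈ LinearMap.range m}
      mul_mem' := fun {u v} hu hv w hw => by rw [mul_assoc]; exact hu _ (hv w hw)
      add_mem' := fun {u v} hu hv w hw => by
        rw [add_mul]; exact Submodule.add_mem _ (hu w hw) (hv w hw)
      algebraMap_mem' := fun c w hw => by
        rw [← Algebra.smul_def]; exact Submodule.smul_mem _ c hw }
  have : u * 1 ∈ LinearMap.range m := by
    refine mem_of_ι_mem S ?_ u 1 ⟨1 ⊗ₜ 1, by rw [m_one, map_one]⟩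
    rintro y _ ⟨v, rfl⟩
    exact ⟨tensorAction h v y, m_action v y⟩
  rwa [mul_one] at this

end TriangularDecomposition

/-! ### Diagonalizability and integrality of `h` on finite-dimensional `sl₂`-modules. -/

section Sl2

open LieModule

variable {F L M : Type*} [Field F] [CharZero F] [LieRing L] [LieAlgebra F L]
  [AddCommGroup M] [Module F M] [LieRingModule L M] [LieModule F L M] [FiniteDimensional F M]
  {h e f : L}

/-- Every weight vector can be raised to a primitive vector. -/
theorem exists_pow_hasPrimitiveVectorWith (t : IsSl2Triple h e f) {μ : F} {m : M}
    (hm : m ≠ 0) (hμ : ⁅h, m⁆ = μ • m) :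
    ∃ n : ℕ, t.HasPrimitiveVectorWith ((toEnd F L M e ^ n) m) (μ + 2 * n) := by
  -- Otherwise the vectors `e^k m` would have infinitely many distinct eigenvalues `μ + 2k`.
  have hz : ∃ k, (toEnd F L M e ^ k) m = 0 := by
    by_contra! contra
    have h_inj : Function.Injective fun n : ℕ => μ + 2 * (n : F) := fun a b hab => by
      simpa using hab
    have aux (ν : Set.range fun n : ℕ => μ + 2 * (n : F)) :
        (toEnd F L M h).HasEigenvector ν ((toEnd F L M e ^ ν.2.choose) m) := by
      refine ⟨?_, contra _⟩
      rw [Module.End.mem_eigenspace_iff, toEnd_apply_apply, t.lie_h_pow_toEnd_e hμ]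
      exact congrArg (· • _) ν.2.choose_spec
    have := ((toEnd F L M h).eigenvectors_linearIndependent _ _ aux).finite
    exact (Set.infinite_range_of_injective h_inj) (Set.toFinite _)
  obtain ⟨n, hn, hn'⟩ := Nat.exists_not_and_succ_of_not_zero_of_exists
    (p := fun k => (toEnd F L M e ^ k) m = 0) hm hz
  exact ⟨n, hn, t.lie_h_pow_toEnd_e hμ n, by rwa [IsSl2Triple.lie_e_pow_toEnd_e]⟩

/-- The weights of a finite-dimensional `sl₂`-module are integers. -/
theorem exists_int_of_weight (t : IsSl2Triple h e f) {μ : F} {m : M} (hm : m ≠ 0)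
    (hμ : ⁅h, m⁆ = μ • m) : ∃ k : ℤ, μ = k := by
  obtain ⟨n, P⟩ := exists_pow_hasPrimitiveVectorWith t hm hμ
  obtain ⟨l, hl⟩ := P.exists_nat
  exact ⟨l - 2 * n, by push_cast; linear_combination hl⟩

/-- On vectors of positive weight `e f` has no non-positive eigenvalue. -/
theorem eq_zero_of_lie_e_lie_f (t : IsSl2Triple h e f) {k : ℕ} (hk : 0 < k) (c : ℕ) {m : M}
    (hm : ⁅h, m⁆ = (k : F) • m) (hc : ⁅e, ⁅f, m⁆⁆ = -((c : F) • m)) : m = 0 := by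
  by_contra h0
  obtain ⟨n, P⟩ := exists_pow_hasPrimitiveVectorWith t h0 hm
  -- Induct on the nilpotency order of `e` at `m`, with `k` and `c` free: passing to `e m` replaces
  -- `(k, c)` by `(k + 2, c + k)`. Allowing all `c ≥ 0`, not just `c = 0`, makes the induction
  -- close.
  suffices ∀ (n k c : ℕ), 0 < k → ∀ m : M, ⁅h, m⁆ = (k : F) • m →
      ⁅e, ⁅f, m⁆⁆ = -((c : F) • m) → (toEnd F L M e ^ (n + 1)) m = 0 → m = 0 by
    refine h0 (this n k c hk m hm hc ?_)
    rw [pow_succ']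
    exact P.lie_e
  clear * - t
  intro n
  induction n with
  | zero =>
    intro k c hk m hm hc he
    have he : ⁅e, m⁆ = 0 := by simpa using he
    have h1 : ⁅e, ⁅f, m⁆⁆ = (k : F) • m := by rw [leibniz_lie, t.lie_e_f, he, lie_zero, add_zero, hm]
    rw [hc, neg_eq_iff_add_eq_zero, ← add_smul] at h1
    refine (smul_eq_zero.1 h1).resolve_left ?_
    norm_cast
    omega
  | succ n ih =>
    intro k c hk m hm hc he
    have h1 : ⁅e, m⁆ = 0 := by
      refine ih (k + 2) (c + k) (by omega) _ ?_ ?_ ?_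
      · rw [leibniz_lie, IsSl2Triple.lie_h_e_smul F t, hm, smul_lie, lie_smul, ← add_smul]
        push_cast
        rw [add_comm]
      · have : ⁅f, ⁅e, m⁆⁆ = -(((c + k : ℕ) : F) • m) := by
          rw [leibniz_lie f, ← lie_skew f e, t.lie_e_f, neg_lie, hm, hc]
          push_cast
          module
        rw [this, lie_neg, lie_smul]
      · rw [pow_succ] at he
        exact he
    refine ih k c hk m hm hc ?_
    rw [pow_succ, Module.End.mul_apply, toEnd_apply_apply, h1, map_zero]

/-- The raising operator is surjective onto positive weight spaces. -/
theorem exists_lie_e_eq (t : IsSl2Triple h e f) {k : ℕ} (hk : 0 < k) {m : M}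
    (hm : ⁅h, m⁆ = (k : F) • m) : ∃ u : M, ⁅h, u⁆ = ((k : F) - 2) • u ∧ ⁅e, u⁆ = m := by
  have hf : ∀ m ∈ (toEnd F L M h).eigenspace (k : F), ⁅h, ⁅f, m⁆⁆ = ((k : F) - 2) • ⁅f, m⁆ := by
    intro m hm
    rw [Module.End.mem_eigenspace_iff, toEnd_apply_apply] at hm
    rw [leibniz_lie, t.lie_lie_smul_f F, hm, neg_lie, smul_lie, lie_smul, sub_smul]
    abel
  let T : (toEnd F L M h).eigenspace (k : F) →ₗ[F] (toEnd F L M h).eigenspace (k : F) :=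
    (toEnd F L M e ∘ₗ toEnd F L M f).restrict fun m hm => by
      rw [Module.End.mem_eigenspace_iff, toEnd_apply_apply]
      change ⁅h, ⁅e, ⁅f, m⁆⁆⁆ = (k : F) • ⁅e, ⁅f, m⁆⁆
      rw [leibniz_lie, IsSl2Triple.lie_h_e_smul F t, hf m hm, smul_lie, lie_smul, sub_smul]
      abel
  -- The case `c = 0` makes `e f` injective, hence bijective, on the finite-dimensional weight
  -- space.
  have hT : Function.Injective T := by
    rw [injective_iff_map_eq_zero]
    rintro ⟨m, hm⟩ h0
    have h0 : ⁅e, ⁅f, m⁆⁆ = 0 := congrArg Subtype.val h0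
    exact Subtype.ext (eq_zero_of_lie_e_lie_f (F := F) t hk 0
      (Module.End.mem_eigenspace_iff.1 hm) (by simpa using h0))
  obtain ⟨⟨u, hu⟩, hum⟩ := LinearMap.injective_iff_surjective.1 hT
    ⟨m, Module.End.mem_eigenspace_iff.2 hm⟩
  exact ⟨⁅f, u⁆, hf u hu, congrArg Subtype.val hum⟩

/-- There are no Jordan blocks for `h` on the kernel of `e`. -/
theorem eq_zero_of_lie_e_eq_zero (t : IsSl2Triple h e f) {μ : F} {v w : M} (hv : ⁅e, v⁆ = 0)
    (hvw : ⁅h, v⁆ = μ • v + w) (hw : ⁅h, w⁆ = μ • w) (hew : ⁅e, w⁆ = 0) : w = 0 := by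
  by_contra h0
  have P : t.HasPrimitiveVectorWith w μ := ⟨h0, hw, hew⟩
  obtain ⟨n, rfl⟩ := P.exists_nat
  have hh : ∀ j : ℕ, ⁅h, (toEnd F L M f ^ j) v⁆ =
      ((n : F) - 2 * j) • (toEnd F L M f ^ j) v + (toEnd F L M f ^ j) w := by
    intro j
    induction j with
    | zero => simpa using hvw
    | succ j ih =>
      rw [pow_succ', Module.End.mul_apply, Module.End.mul_apply, toEnd_apply_apply,
        toEnd_apply_apply, leibniz_lie, t.lie_lie_smul_f F, ih, neg_lie, smul_lie, lie_add,
        lie_smul]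
      push_cast
      module
  have he : ∀ j : ℕ, ⁅e, (toEnd F L M f ^ (j + 1)) v⁆ =
      (((j : F) + 1) * (n - j)) • (toEnd F L M f ^ j) v +
        ((j : F) + 1) • (toEnd F L M f ^ j) w := by
    intro j
    induction j with
    | zero => simp [leibniz_lie e, t.lie_e_f, hvw, hv]
    | succ j ih =>
      rw [pow_succ', Module.End.mul_apply, toEnd_apply_apply, leibniz_lie, t.lie_e_f, hh, ih,
        lie_add, lie_smul, lie_smul, pow_succ' _ j]
      simp only [Module.End.mul_apply, toEnd_apply_apply]
      push_cast
      module
  -- Since `f^(n+1) w = 0`, this vector has weight `-(n + 2)`, which is positive for the reversed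
  -- triple, and `f e` kills it. Its vanishing forces `(n + 1) f^n w = 0`, which is impossible for a
  -- primitive vector `w` of weight `n`.
  have hu : (toEnd F L M f ^ (n + 1)) v = 0 := by
    refine eq_zero_of_lie_e_lie_f (F := F) t.symm (k := n + 2) (by omega) 0 ?_ ?_
    · rw [neg_lie, hh, P.pow_toEnd_f_eq_zero_of_eq_nat rfl]
      push_cast
      module
    · have := P.pow_toEnd_f_eq_zero_of_eq_nat rfl
      rw [pow_succ', Module.End.mul_apply, toEnd_apply_apply] at this
      rw [he, sub_self, mul_zero, zero_smul, zero_add, lie_smul, this]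
      simp
  have h1 := he n
  rw [hu, lie_zero, sub_self, mul_zero, zero_smul, zero_add] at h1
  refine P.pow_toEnd_f_ne_zero_of_eq_nat rfl le_rfl ((smul_eq_zero.1 h1.symm).resolve_left ?_)
  norm_cast

/-- There are no Jordan blocks for `h` on a finite-dimensional `sl₂`-module. -/
theorem lie_h_eq_smul_of_sq (t : IsSl2Triple h e f) {μ : F} {v w : M}
    (hvw : ⁅h, v⁆ = μ • v + w) (hw : ⁅h, w⁆ = μ • w) : w = 0 := by
  by_contra h0
  obtain ⟨n, P⟩ := exists_pow_hasPrimitiveVectorWith t h0 hw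
  have hh : ∀ j : ℕ, ⁅h, (toEnd F L M e ^ j) v⁆ =
      (μ + 2 * j) • (toEnd F L M e ^ j) v + (toEnd F L M e ^ j) w := by
    intro j
    induction j with
    | zero => simpa using hvw
    | succ j ih =>
      rw [pow_succ', Module.End.mul_apply, Module.End.mul_apply, toEnd_apply_apply,
        toEnd_apply_apply, leibniz_lie, IsSl2Triple.lie_h_e_smul F t, ih, smul_lie, lie_add,
        lie_smul]
      push_cast
      module
  have hv := hh n
  set v' := (toEnd F L M e ^ n) v
  set w' := (toEnd F L M e ^ n) w
  obtain ⟨l, hl⟩ := P.exists_nat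
  rw [hl] at hv P
  have hev : ⁅h, ⁅e, v'⁆⁆ = ((l + 2 : ℕ) : F) • ⁅e, v'⁆ := by
    rw [leibniz_lie, IsSl2Triple.lie_h_e_smul F t, hv, smul_lie, lie_add, lie_smul, P.lie_e]
    push_cast
    module
  -- Although `v'` need not be a weight vector, `e v'` is, because `e w' = 0`. Subtracting the
  -- weight vector `u` makes `v' - u` killed by `e` and keeps the Jordan block.
  obtain ⟨u, hu, heu⟩ := exists_lie_e_eq t (by omega) hev
  refine P.ne_zero (eq_zero_of_lie_e_eq_zero t (v := v' - u) (μ := (l : F)) ?_ ?_ P.lie_h P.lie_e)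
  · rw [lie_sub, heu, sub_self]
  · rw [lie_sub, hv, hu]
    push_cast
    module

/-- A finite-dimensional `sl₂`-module is the sum of its integral weight spaces. -/
theorem iSup_eigenspace_eq_top [IsAlgClosed F] (t : IsSl2Triple h e f) :
    ⨆ k : ℤ, (toEnd F L M h).eigenspace (k : F) = ⊤ := by
  rw [eq_top_iff, ← Module.End.iSup_maxGenEigenspace_eq_top (toEnd F L M h)]
  refine iSup_le fun μ => ?_
  have hle : (toEnd F L M h).maxGenEigenspace μ ≤ (toEnd F L M h).eigenspace μ := by
    have hn : ∀ (n : ℕ) (v : M), ((toEnd F L M h - algebraMap F _ μ) ^ n) v = 0 →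
        (toEnd F L M h - algebraMap F _ μ) v = 0 := by
      intro n
      induction n with
      | zero => intro v hv; rw [show v = 0 from hv, map_zero]
      | succ n ih =>
        intro v hv
        rw [pow_succ, Module.End.mul_apply] at hv
        have h2 := ih _ hv
        refine lie_h_eq_smul_of_sq t (μ := μ) (v := v) (by simp) ?_
        rwa [LinearMap.sub_apply, sub_eq_zero, toEnd_apply_apply] at h2
    intro v hv
    obtain ⟨n, hv⟩ := Module.End.mem_maxGenEigenspace _ _ _ |>.1 hv
    exact Module.End.mem_eigenspace_iff.2 (sub_eq_zero.1 (hn n v hv))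
  refine hle.trans ?_
  by_cases hμ : ∃ k : ℤ, μ = k
  · obtain ⟨k, rfl⟩ := hμ
    exact le_iSup (fun k : ℤ => (toEnd F L M h).eigenspace (k : F)) k
  · intro v hv
    have : v = 0 := by
      by_contra h0
      exact hμ (exists_int_of_weight t h0 (Module.End.mem_eigenspace_iff.1 hv))
    rw [this]
    exact Submodule.zero_mem _

end Sl2

/-! ### The splitting of `𝔤` by the grading. -/

namespace Data

variable {F 𝔤 : Type*} [Field F] [CharZero F] [LieRing 𝔤] [LieAlgebra F 𝔤] (D : Data F 𝔤)

theorem iSup_gr_eq_top [IsAlgClosed F] [FiniteDimensional F 𝔤] : ⨆ k : ℤ, gr F D.x k = ⊤ := by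
  -- `IsSl2Triple` demands `h ≠ 0`, so `x = 0` is separate; then `𝔤` is all of degree `0`.
  by_cases hx : D.x = 0
  · refine eq_top_iff.2 (le_iSup_of_le 0 fun a _ => ?_)
    rw [mem_gr, hx]
    simp
  · have t : IsSl2Triple ((2 : F) • D.x) D.e D.f :=
      { h_ne_zero := smul_ne_zero two_ne_zero hx
        lie_e_f := D.lie_e_f
        lie_h_e_nsmul := by rw [smul_lie, D.lie_x_e, ofNat_smul_eq_nsmul]
        lie_h_f_nsmul := by rw [smul_lie, D.lie_x_f, smul_neg, ofNat_smul_eq_nsmul] }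
    rw [← iSup_eigenspace_eq_top (F := F) (M := 𝔤) t]
    congr 1
    ext k a
    rw [mem_gr, Module.End.mem_eigenspace_iff, LieModule.toEnd_apply_apply, smul_lie]
    constructor
    · intro h
      rw [h, smul_smul]
      congr 1
      ring
    · intro h
      rw [div_eq_inv_mul, mul_smul, ← h, smul_smul, inv_mul_cancel₀ two_ne_zero, one_smul]

/-- Eigenspaces are independent, and with doubled degrees every integer index is `≤ 0` or `≥ 1`. -/
theorem isCompl_gLE0_gGEhalf [IsAlgClosed F] [FiniteDimensional F 𝔤] :
    IsCompl D.gLE0.toSubmodule D.gGEhalf.toSubmodule := by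
  constructor
  · have hind : iSupIndep (gr F D.x) :=
      (Module.End.eigenspaces_iSupIndep (LieAlgebra.ad F 𝔤 D.x)).comp
        (f := fun k : ℤ => (k : F) / 2) fun j k hjk => by
          simpa using hjk
    have := hind.disjoint_biSup_biSup (s := {k : ℤ | k ≤ 0}) (t := {k : ℤ | 1 ≤ k})
      (Set.disjoint_left.2 fun k (h1 : k ≤ 0) (h2 : 1 ≤ k) => by omega)
    exact this
  · rw [codisjoint_iff, eq_top_iff, ← D.iSup_gr_eq_top]
    refine iSup_le fun k => ?_
    rcases le_or_gt k 0 with hk | hk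
    · exact le_sup_of_le_left (le_iSup₂_of_le (f := fun k (_ : k ≤ 0) => gr F D.x k) k hk le_rfl)
    · exact le_sup_of_le_right (le_iSup₂_of_le (f := fun k (_ : 1 ≤ k) => gr F D.x k) k hk le_rfl)

theorem pbwMul_bijective [IsAlgClosed F] [FiniteDimensional F 𝔤] : Function.Bijective D.pbwMul :=
  mul_incl_bijective D.isCompl_gLE0_gGEhalf

end Data

/-! ### The map `ρ`, its kernel and its multiplicativity. -/

namespace Data

variable {F 𝔤 : Type*} [Field F] [CharZero F] [LieRing 𝔤] [LieAlgebra F 𝔤] (D : Data F 𝔤)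

theorem pbwMul_tmul (A : UniversalEnvelopingAlgebra F D.gLE0)
    (q : UniversalEnvelopingAlgebra F D.gGEhalf) :
    D.pbwMul (A ⊗ₜ q) = incl D.gLE0 A * incl D.gGEhalf q := by
  simp [pbwMul]

variable (h : Function.Bijective D.pbwMul)

theorem ρ_pbwMul (t) :
    D.ρ h (D.pbwMul t) = TensorProduct.map LinearMap.id D.π.toLinearMap t := by
  have : (LinearEquiv.ofBijective D.pbwMul h).symm (D.pbwMul t) = t :=
    (LinearEquiv.ofBijective D.pbwMul h).symm_apply_apply t
  rw [ρ, LinearMap.comp_apply, LinearEquiv.coe_coe, this]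

theorem ρ_incl_mul_incl (A : UniversalEnvelopingAlgebra F D.gLE0)
    (q : UniversalEnvelopingAlgebra F D.gGEhalf) :
    D.ρ h (incl D.gLE0 A * incl D.gGEhalf q) = A ⊗ₜ D.π q := by
  rw [← pbwMul_tmul, ρ_pbwMul]
  rfl

theorem ρ_one : D.ρ h 1 = 1 := by
  have := D.ρ_incl_mul_incl h 1 1
  rwa [map_one, map_one, map_one, one_mul] at this

/-- Linear statements about `U(𝔤)` may be checked on the products `A q`. -/
theorem pbw_induction (h : Function.Bijective D.pbwMul)
    {P : UniversalEnvelopingAlgebra F 𝔤 → Prop} (h0 : P 0)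
    (hadd : ∀ u v, P u → P v → P (u + v))
    (hmul : ∀ A q, P (incl D.gLE0 A * incl D.gGEhalf q)) (u) : P u := by
  obtain ⟨t, rfl⟩ := h.2 u
  induction t with
  | zero => rwa [map_zero]
  | add v w hv hw => rw [map_add]; exact hadd _ _ hv hw
  | tmul A q => rw [pbwMul_tmul]; exact hmul A q

theorem ρ_incl_mul (A : UniversalEnvelopingAlgebra F D.gLE0) (g) :
    D.ρ h (incl D.gLE0 A * g) = (A ⊗ₜ 1) * D.ρ h g := by
  induction g using D.pbw_induction h with
  | h0 => simp
  | hadd u v hu hv => rw [mul_add, map_add, map_add, mul_add, hu, hv]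
  | hmul B q =>
    rw [← mul_assoc, ← map_mul, ρ_incl_mul_incl, ρ_incl_mul_incl,
      Algebra.TensorProduct.tmul_mul_tmul, one_mul]

theorem ρ_mul_incl (g) (q : UniversalEnvelopingAlgebra F D.gGEhalf) :
    D.ρ h (g * incl D.gGEhalf q) = D.ρ h g * (1 ⊗ₜ D.π q) := by
  induction g using D.pbw_induction h with
  | h0 => simp
  | hadd u v hu hv => rw [add_mul, map_add, map_add, add_mul, hu, hv]
  | hmul B r =>
    rw [mul_assoc, ← map_mul, ρ_incl_mul_incl, ρ_incl_mul_incl,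
      Algebra.TensorProduct.tmul_mul_tmul, mul_one, map_mul]

theorem ρ_surjective : Function.Surjective (D.ρ h) := by
  have h1 : Function.Surjective (TensorProduct.map (LinearMap.id (R := F)
      (M := UniversalEnvelopingAlgebra F D.gLE0)) D.π.toLinearMap) :=
    TensorProduct.map_surjective Function.surjective_id (Ideal.Quotient.mkₐ_surjective F _)
  exact h1.comp (LinearEquiv.surjective _)

/-- The inclusion `U(𝔤_{≥1/2}) → U(𝔤)` maps `I_{≥1/2}` into `I`. -/
theorem incl_mem_I {q : UniversalEnvelopingAlgebra F D.gGEhalf} (hq : q ∈ D.IGEhalf) :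
    incl D.gGEhalf q ∈ D.I := by
  have : D.IGEhalf ≤ D.I.comap (incl D.gGEhalf : _ →+* UniversalEnvelopingAlgebra F 𝔤) := by
    refine Ideal.span_le.2 ?_
    rintro _ ⟨m, hm, rfl⟩
    refine Ideal.subset_span ⟨m, hm, ?_⟩
    rw [RingHom.coe_coe, map_sub, incl_ι, AlgHom.commutes]
    rfl
  exact this hq

/-- By right exactness of the tensor product, `ker (id ⊗ π)` is the image of `U(𝔤_{≤0}) ⊗ I_{≥1/2}`,
which multiplication sends into `I`. Conversely, right linearity gives `ρ(g (m - χ(m))) = ρ(g) (1 ⊗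
π(m - χ(m))) = 0`. -/
theorem ker_ρ : LinearMap.ker (D.ρ h) = D.I.restrictScalars F := by
  apply le_antisymm
  · intro u hu
    obtain ⟨t, rfl⟩ := h.2 u
    rw [LinearMap.mem_ker, ρ_pbwMul] at hu
    have hex : Function.Exact (D.IGEhalf.restrictScalars F).subtype D.π.toLinearMap := by
      intro q
      rw [Submodule.coe_subtype, Subtype.range_coe]
      exact Ideal.Quotient.eq_zero_iff_mem
    obtain ⟨s, rfl⟩ := (lTensor_exact (UniversalEnvelopingAlgebra F D.gLE0) hex
      (Ideal.Quotient.mkₐ_surjective F _) t).1 hu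
    rw [Submodule.restrictScalars_mem]
    clear hu
    induction s with
    | zero => simp
    | add v w hv hw =>
      rw [map_add, map_add]
      exact Ideal.add_mem _ hv hw
    | tmul A q =>
      rw [LinearMap.lTensor_tmul, pbwMul_tmul]
      exact Ideal.mul_mem_left _ _ (D.incl_mem_I q.2)
  · intro u hu
    -- The left factor `g` lets the span induction pass through left multiples.
    suffices ∀ g, D.ρ h (g * u) = 0 by simpa using this 1
    rw [Submodule.restrictScalars_mem, I, whittakerIdeal] at hu
    induction hu using Submodule.span_induction with
    | zero => simp
    | add u v _ _ hu hv => intro g; rw [mul_add, map_add, hu g, hv g, add_zero]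
    | smul c u _ hu => intro g; rw [smul_eq_mul, ← mul_assoc]; exact hu _
    | mem u hu =>
      obtain ⟨m, hm, rfl⟩ := hu
      intro g
      have hm' : m ∈ D.gGEhalf := grGE_anti (by norm_num) hm
      have h1 : ι F m - algebraMap F (UniversalEnvelopingAlgebra F 𝔤) (D.χ m) =
          incl D.gGEhalf (ι F ⟨m, hm'⟩ - algebraMap F _ (D.χ m)) := by
        rw [map_sub, incl_ι, AlgHom.commutes]
      have h2 : D.π (ι F ⟨m, hm'⟩ - algebraMap F _ (D.χ m)) = 0 :=
        Ideal.Quotient.eq_zero_iff_mem.2 (Ideal.subset_span ⟨⟨m, hm'⟩, hm, rfl⟩)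
      rw [h1, ρ_mul_incl, h2, TensorProduct.tmul_zero, mul_zero]

theorem ρ_eq_zero {u} : D.ρ h u = 0 ↔ u ∈ D.I := by
  rw [← LinearMap.mem_ker, ker_ρ, Submodule.restrictScalars_mem]

/-- The reason is that `[𝔤_{≥1}, 𝔤_{≥1/2}] ⊆ 𝔤_{≥3/2}`, where `χ` vanishes. -/
theorem I_mul_incl_mem {u} (hu : u ∈ D.I) (q : UniversalEnvelopingAlgebra F D.gGEhalf) :
    u * incl D.gGEhalf q ∈ D.I := by
  let S : Subalgebra F (UniversalEnvelopingAlgebra F D.gGEhalf) :=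
    { carrier := {q | ∀ u ∈ D.I, u * incl D.gGEhalf q ∈ D.I}
      mul_mem' := fun {q r} hq hr u hu => by
        rw [map_mul, ← mul_assoc]; exact hr _ (hq _ hu)
      add_mem' := fun {q r} hq hr u hu => by
        rw [map_add, mul_add]; exact Ideal.add_mem _ (hq _ hu) (hr _ hu)
      algebraMap_mem' := fun c u hu => by
        rw [AlgHom.commutes, ← Algebra.commutes]; exact Ideal.mul_mem_left _ _ hu }
  refine mem_of_ι_mem S (fun a u hu => ?_) q u hu
  rw [incl_ι]
  exact whittakerIdeal_mul_ι_mem (fun _ hm => D.lie_mem_and_χ hm a.2) hu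

/-- `[q, w] 1̄ = 0` for all `q ∈ U(𝔤_{≥1/2})` and `w ∈ W̃`. -/
theorem commutator_mem_I {w} (hw : w ∈ D.Wtilde) (q : UniversalEnvelopingAlgebra F D.gGEhalf) :
    incl D.gGEhalf q * w - w * incl D.gGEhalf q ∈ D.I := by
  let S : Subalgebra F (UniversalEnvelopingAlgebra F D.gGEhalf) :=
    { carrier := {q | incl D.gGEhalf q * w - w * incl D.gGEhalf q ∈ D.I}
      mul_mem' := fun {q r} hq hr => by
        -- Leibniz rule `[q r, w] = q [r, w] + [q, w] r`; the second term needs right stability of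
        -- `I`.
        have h1 := Ideal.add_mem _ (Ideal.mul_mem_left D.I (incl D.gGEhalf q) hr)
          (D.I_mul_incl_mem hq r)
        rw [Set.mem_ofPred_eq, map_mul]
        convert h1 using 1
        noncomm_ring
      add_mem' := fun {q r} hq hr => by
        rw [Set.mem_ofPred_eq, map_add, add_mul, mul_add, add_sub_add_comm]
        exact Ideal.add_mem _ hq hr
      algebraMap_mem' := fun c => by
        rw [Set.mem_ofPred_eq, AlgHom.commutes, Algebra.commutes, sub_self]
        exact Ideal.zero_mem _ }
  refine mem_of_ι_mem S (fun a => ?_) q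
  change incl D.gGEhalf (ι F a) * w - w * incl D.gGEhalf (ι F a) ∈ D.I
  rw [incl_ι]
  exact D.toM_eq_zero.1 (hw a a.2)

theorem toOp_tmul (A : UniversalEnvelopingAlgebra F D.gLE0) (p : D.Weyl) :
    D.toOp (A ⊗ₜ p) = A ⊗ₜ MulOpposite.op p := rfl

/-- This is where the opposite product enters: right multiplication by `p` in the Weyl factor
becomes left multiplication. -/
theorem toOp_mul_mul (A : UniversalEnvelopingAlgebra F D.gLE0) (p : D.Weyl) (X : D.U) :
    D.toOp ((A ⊗ₜ 1) * (X * (1 ⊗ₜ p))) = (A ⊗ₜ MulOpposite.op p) * D.toOp X := by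
  induction X using TensorProduct.induction_on with
  | zero => rw [zero_mul, mul_zero, LinearEquiv.map_zero, mul_zero]
  | add X Y hX hY => rw [add_mul, mul_add, LinearEquiv.map_add, LinearEquiv.map_add, mul_add, hX, hY]
  | tmul B r =>
    rw [toOp_tmul]
    simp only [Algebra.TensorProduct.tmul_mul_tmul, mul_one, one_mul, toOp_tmul,
      MulOpposite.op_mul]

/-- Only the right factor needs to lie in `W̃`: it is the one past which `q` is moved. -/
theorem toOp_ρ_mul (u) {w} (hw : w ∈ D.Wtilde) :
    D.toOp (D.ρ h (u * w)) = D.toOp (D.ρ h u) * D.toOp (D.ρ h w) := by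
  induction u using D.pbw_induction h with
  | h0 => rw [zero_mul, map_zero, LinearEquiv.map_zero, zero_mul]
  | hadd u v hu hv => 
    rw [add_mul, LinearMap.map_add, LinearMap.map_add, LinearEquiv.map_add, LinearEquiv.map_add,
      add_mul, hu, hv]
  | hmul A q =>
    have h1 := (D.ρ_eq_zero h).2 (D.commutator_mem_I hw q)
    rw [map_sub, sub_eq_zero, ρ_mul_incl] at h1
    rw [mul_assoc, ρ_incl_mul, h1, toOp_mul_mul, ρ_incl_mul_incl, toOp_tmul]

/-- The restriction of `ρ` to `W̃`, as a homomorphism of algebras. -/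
def ρW : D.Wtilde →ₐ[F] D.Uop :=
  AlgHom.ofLinearMap (D.toOp.toLinearMap ∘ₗ D.ρ h ∘ₗ D.Wtilde.val.toLinearMap)
    (by
      change D.toOp (D.ρ h 1) = 1
      rw [ρ_one]
      rfl)
    fun v w => D.toOp_ρ_mul h v w.2

theorem ρW_apply (w : D.Wtilde) : D.ρW h w = D.toOp (D.ρ h w) := rfl

theorem ρW_eq_zero {w : D.Wtilde} : D.ρW h w = 0 ↔ w ∈ D.IW := by
  rw [ρW_apply, LinearEquiv.map_eq_zero_iff, ρ_eq_zero, mem_IW]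

/-- The linear bijection `M → U` induced by `ρ`. -/
def ρM : D.M ≃ₗ[F] D.U :=
  (Submodule.Quotient.restrictScalarsEquiv F D.I).symm ≪≫ₗ
    Submodule.quotEquivOfEq _ _ (D.ker_ρ h).symm ≪≫ₗ
    (D.ρ h).quotKerEquivOfSurjective (D.ρ_surjective h)

theorem ρM_toM (g) : D.ρM h (D.toM g) = D.ρ h g := rfl

end Data

end FiniteW

end

theorem proposition3p6 {F 𝔤 : Type*} [Field F] [IsAlgClosed F] [CharZero F]
    [LieRing 𝔤] [LieAlgebra F 𝔤] [FiniteDimensional F 𝔤] [LieAlgebra.HasCentralRadical F 𝔤]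
    (D : FiniteW.Data F 𝔤) :
    ∃ h : Function.Bijective D.pbwMul,
      Function.Surjective (D.ρ h) ∧
      (LinearMap.ker (D.ρ h) = D.I.restrictScalars F) ∧
      (∃ φ : D.Wtilde →ₐ[F] D.Uop, ∀ w : D.Wtilde, φ w = D.toOp (D.ρ h w)) ∧
      (∃ ρbar : D.M ≃ₗ[F] D.U, (∀ g, ρbar (D.toM g) = D.ρ h g) ∧
        ∃ ψ : D.W →ₐ[F] D.Uop, Function.Injective ψ ∧
          ∀ w : D.W, ψ w = D.toOp (ρbar (D.WtoM w))) := by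
  refine ⟨D.pbwMul_bijective, D.ρ_surjective _, D.ker_ρ _,
    ⟨D.ρW D.pbwMul_bijective, D.ρW_apply _⟩, D.ρM D.pbwMul_bijective, D.ρM_toM _,
    Ideal.Quotient.liftₐ D.IW (D.ρW D.pbwMul_bijective) fun w hw => (D.ρW_eq_zero _).2 hw,
    ?_, ?_⟩
  · rw [injective_iff_map_eq_zero]
    intro y hy
    obtain ⟨w, rfl⟩ := Ideal.Quotient.mkₐ_surjective F D.IW y
    exact Ideal.Quotient.eq_zero_iff_mem.2 ((D.ρW_eq_zero _).1 hy)
  · intro y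
    obtain ⟨w, rfl⟩ := Ideal.Quotient.mkₐ_surjective F D.IW y
    rfl
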